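/- **Isomorphism of universal abutments.** Let $R$ be a unital ring. A *$(\mathbb Z\times\mathbb Z)$-bigraded exact couple* $\mathcal C=(E,D,i,j,k)$ of $R$-modules consists of bigraded modules $D,E$ and maps $i\colon D\to D$, $j\colon D\to E$, $k\colon E\to D$ of bidegrees $a,b,c\in\mathbb Z\times\mathbb Z$ with $\ker i=\operatorname{im}k$, $\ker j=\operatorname{im}i$, $\ker k=\operatorname{im}j$ in all positions. It is *regular* if $\sigma:=\det[a\ \ (b+c)]\in\{\pm1\}$. A morphism $f$ of exact couples with the same bidegrees is a family of $R$-linear maps $D_x(1)\to D_x(2)$, $E_x(1)\to E_x(2)$ commuting with $i,j,k$. For $n\in\mathbb Z$ put $x(n)=\sigma n(b+c)$; the positions $x$ with $\det[a\ \ x]=n$ are exactly $x(n)+ra$, $r\in\mathbb Z$. Let $D(n)$ be the diagram $\cdots\to D_{x(n)-a}\xrightarrow{i}D_{x(n)}\xrightarrow{i}D_{x(n)+a}\to\cdots$, and let $L_n=\operatorname{colim}D(n)$ and $L^n=\lim D(n)$ be the *colimit abutment* and the *limit abutment*. For $x=x(n)+ra$ put $$L_x=\operatorname{im}(D_x\to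 L_n),\quad L^x=\ker(L^n\to D_x),\quad e_x=L_x/L_{x-a},\quad e^x=L^{x+a}/L^x .$$ In position $y$ let $Z^r_y=k^{-1}(\operatorname{im}(i^r\colon D_{y+c-ra}\to D_{y+c}))$ and $B^r_y=j(\ker (i^r\colon D_{y-b}\to D_{y-b+ra}))$, so that $E^{r+1}_y=Z^r_y/B^r_y$ are the objects of the spectral sequence of $\mathcal C$, with limit page $E^\infty_y=\bigcap_rZ^r_y\big/\bigcup_rB^r_y$. For an ordinal $\tau$ let $I^\tau\subseteq D$ be the $\tau$-fold image subdiagram of $D$ under $i$ ($I^0=D$, $I^{\tau+1}=i(I^\tau)$, intersections at limit ordinals) and $Q^\tau$ the $\tau$-fold image quotient diagram of $D$ ($Q^0=D$, $Q^{\tau+1}$ the image of the structure map of $Q^\tau$ viewed as a quotient of $Q^\tau$, colimits at limit ordinals); put $Z^\tau_y=k^{-1}(I^\tau_{y+c})$, $B^\tau_y=j(\ker(D_{y-b}\to Q^\tau_{y-b}))$ and $E^{\tau+1}_y=Z^\tau_y/B^\tau_y$. For large $\tau$ these are constant, equal to the *stable object* $\bar E_y$, and there is a canonical map $\bar E_y\to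 E^\infty_y$; $E^\infty_y$ is *stable* if this map is an isomorphism. Let $f\colon\mathcal C(1)\to\mathcal C(2)$ be a morphism of regular exact couples (with the same bidegrees $a,b,c$), and let $n\in\mathbb Z$. Suppose: 1. For all $x$ with $\det[a\ \ x]=n$ and $i=1,2$, $E^\infty_{x+b}(i)$ is stable. 2. For all $x$ with $\det[a\ \ x]=n$, $f^\infty\colon E^\infty_{x+b}(1)\to E^\infty_{x+b}(2)$ is an isomorphism. 3. For each $r\in\mathbb Z$, the map $e_{x(n)+ra}(1)\to e_{x(n)+ra}(2)$ is an epimorphism or the map $e^{x(n+\sigma)+ra}(1)\to e^{x(n+\sigma)+ra}(2)$ is a monomorphism. 4. $L_nf$ induces an isomorphism $\lim_rL_{x(n)+ra}(1)\to\lim_rL_{x(n)+ra}(2)$. 5. $L_nf$ induces a monomorphism $\lim^1_rL_{x(n)+ra}(1)\to\lim^1_rL_{x(n)+ra}(2)$. 6. $L_{n+\sigma}f$ induces an isomorphism $\operatorname{im}(L^{n+\sigma}(1)\to L_{n+\sigma}(1))\to\operatorname{im}(L^{n+\sigma}(2)\to L_{n+\sigma}(2))$. Then $f$ induces isomorphisms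 $L_nf\colon L_n(1)\to L_n(2)$ and $L^{n+\sigma}f\colon L^{n+\sigma}(1)\to L^{n+\sigma}(2)$. -/

import Mathlib

universe u v

noncomputable section

namespace ExactCouples

/-! ### Subquotients of a module -/

section Subquotients

variable {R : Type u} [Ring R] {M N : Type v} [AddCommGroup M] [Module R M]
  [AddCommGroup N] [Module R N]

/-- The subquotient `Z / (B ∩ Z)` of a module; in all uses below `B ≤ Z`, so that it is `Z / B`. -/
abbrev Subquot (Z B : Submodule R M) : Type v := ↥Z ⧸ B.submoduleOf Z

/-- The map `Z / B → Z' / B'` induced by a linear map that carries `Z` to `Z'` and `B` to `B'`. -/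
def Subquot.map {Z B : Submodule R M} {Z' B' : Submodule R N} (f : M →ₗ[R] N)
    (hZ : ∀ x ∈ Z, f x ∈ Z') (hB : ∀ x ∈ B, f x ∈ B') : Subquot Z B →ₗ[R] Subquot Z' B' :=
  Submodule.mapQ _ _ (f.restrict hZ) fun x hx => hB x.1 hx

end Subquotients

/-! ### Diagrams indexed by an abelian group, with structure maps that raise the index by `a` -/

/-- A family of `R`-modules indexed by an abelian group `ι`, with a structure map
`obj x → obj (x + a)` for every `x`. The target is named by a variable `y` with `x + a = y`, so that
no transport along equalities of indices is needed. -/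
structure ShiftDiagram (R : Type u) [Ring R] (ι : Type) [AddCommGroup ι] (a : ι) where
  obj : ι → ModuleCat.{v} R
  map : ∀ x y : ι, x + a = y → (obj x →ₗ[R] obj y)

/-- Diagrams `⋯ → A (p-1) → A p → A (p+1) → ⋯` of `R`-modules indexed by the integers. -/
abbrev ZDiagram (R : Type u) [Ring R] := ShiftDiagram.{u, v} R ℤ 1

namespace ShiftDiagram

section General

variable {R : Type u} [Ring R] {ι : Type} [AddCommGroup ι] {a : ι}

/-- Morphisms of diagrams: families of linear maps that commute with the structure maps. -/
structure Hom (A B : ShiftDiagram.{u, v} R ι a) where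
  app : ∀ x, A.obj x →ₗ[R] B.obj x
  comm : ∀ x y (h : x + a = y) (t : A.obj x), app y (A.map x y h t) = B.map x y h (app x t)

/-- The identity map between the modules at two equal indices. -/
def eqMap (A : ShiftDiagram.{u, v} R ι a) {x y : ι} (h : x = y) : A.obj x →ₗ[R] A.obj y :=
  h ▸ LinearMap.id

/-- The composite of `n` consecutive structure maps, `A x → A (x + n a)`. -/
def iter (A : ShiftDiagram.{u, v} R ι a) :
    ∀ (n : ℕ) (x y : ι), x + n • a = y → (A.obj x →ₗ[R] A.obj y)
  | 0, _, _, h => A.eqMap (by simpa using h)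
  | n + 1, x, y, h =>
      A.map (x + n • a) y (by rw [← h, succ_nsmul, add_assoc]) ∘ₗ A.iter n x (x + n • a) rfl

/-- One step of the image subdiagram construction: a family `S` of submodules is sent to the family
of the images of its members under the structure maps. -/
def imgOp (A : ShiftDiagram.{u, v} R ι a) :
    (∀ x, Submodule R (A.obj x)) →o (∀ x, Submodule R (A.obj x)) where
  toFun S y := (S (y - a)).map (A.map (y - a) y (sub_add_cancel y a))
  monotone' _ _ h y := Submodule.map_mono (h (y - a))

/-- One step of the image quotient construction, on the level of kernels: if `K` is the family of
the kernels of the projections from `A` to a quotient diagram `Q`, then `A.kerOp K` is the family of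
the kernels of the projections from `A` to the image quotient diagram of `Q`. -/
def kerOp (A : ShiftDiagram.{u, v} R ι a) :
    (∀ x, Submodule R (A.obj x)) →o (∀ x, Submodule R (A.obj x)) where
  toFun K x := (K (x + a)).comap (A.map x (x + a) rfl)
  monotone' _ _ h x := Submodule.comap_mono (h (x + a))

/-- The `τ`-th image subdiagram `I^τ A` of `A`, for an ordinal `τ`: it is `A` for `τ = 0`, the image
of `I^σ A` under the structure maps for `τ = σ + 1`, and the intersection of the earlier stages for
a limit ordinal `τ`. -/
def imgSub (A : ShiftDiagram.{u, v} R ι a) (τ : Ordinal.{v}) (x : ι) : Submodule R (A.obj x) :=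
  OrdinalApprox.gfpApprox A.imgOp ⊤ τ x

/-- The kernel of the projection from `A` to its `τ`-th image quotient diagram `Q^τ A`, for an
ordinal `τ`: it is `0` for `τ = 0`, it is given by `kerOp` at successors, and it is the union of the
earlier stages for a limit ordinal `τ` (where `Q^τ A` is the colimit of the earlier stages). -/
def quoKer (A : ShiftDiagram.{u, v} R ι a) (τ : Ordinal.{v}) (x : ι) : Submodule R (A.obj x) :=
  OrdinalApprox.lfpApprox A.kerOp ⊥ τ x

/-- An ordinal at which the image subdiagrams and the image quotient diagrams of `A` have become
stable, see `imgSub_eq_of_stabOrd_le` and `quoKer_eq_of_stabOrd_le`. -/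
def stabOrd (A : ShiftDiagram.{u, v} R ι a) : Ordinal.{v} :=
  (Order.succ (Cardinal.mk (∀ x, Submodule R (A.obj x)))).ord

theorem imgSub_eq_of_stabOrd_le (A : ShiftDiagram.{u, v} R ι a) {τ : Ordinal.{v}}
    (h : A.stabOrd ≤ τ) (x : ι) : A.imgSub τ x = A.imgSub A.stabOrd x := by
  have := OrdinalApprox.gfpApprox_eq_of_mem_fixedPoints A.imgOp h
    (OrdinalApprox.gfpApprox_ord_mem_fixedPoint A.imgOp le_top)
  exact congrFun this x

theorem quoKer_eq_of_stabOrd_le (A : ShiftDiagram.{u, v} R ι a) {τ : Ordinal.{v}}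
    (h : A.stabOrd ≤ τ) (x : ι) : A.quoKer τ x = A.quoKer A.stabOrd x := by
  have := OrdinalApprox.lfpApprox_eq_of_mem_fixedPoints A.kerOp h
    (OrdinalApprox.lfpApprox_ord_mem_fixedPoint A.kerOp bot_le)
  exact congrFun this x

theorem imgSub_stabOrd_le (A : ShiftDiagram.{u, v} R ι a) (τ : Ordinal.{v}) (x : ι) :
    A.imgSub A.stabOrd x ≤ A.imgSub τ x :=
  OrdinalApprox.le_gfpApprox_of_mem_fixedPoints A.imgOp
    (OrdinalApprox.gfpApprox_ord_mem_fixedPoint A.imgOp le_top) le_top τ x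

theorem iter_succ' (A : ShiftDiagram.{u, v} R ι a) (n : ℕ) (x y z : ι) (h : x + a = y)
    (h' : y + n • a = z) (h'' : x + (n + 1) • a = z) (t : A.obj x) :
    A.iter (n + 1) x z h'' t = A.iter n y z h' (A.map x y h t) := by
  induction n generalizing z with
  | zero =>
    obtain rfl : y = z := by simpa using h'
    have e : x = x + 0 • a := by simp
    change A.map (x + 0 • a) y _ (A.eqMap e t) = A.map x y h t
    have key : ∀ (w : ι) (e : x = w) (hw : w + a = y),
        A.map w y hw (A.eqMap e t) = A.map x y h t := by
      rintro w rfl hw; rfl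
    exact key _ e _
  | succ n ih =>
    have hz : x + (n + 1) • a = y + n • a := by rw [← h, succ_nsmul']; abel
    change A.map (x + (n + 1) • a) z _ (A.iter (n + 1) x (x + (n + 1) • a) rfl t) =
      A.map (y + n • a) z _ (A.iter n y (y + n • a) rfl (A.map x y h t))
    rw [← ih (y + n • a) rfl hz]
    have key : ∀ (w : ι) (hw : x + (n + 1) • a = w) (hwz : w + a = z),
        A.map (x + (n + 1) • a) z (by rw [hw, hwz]) (A.iter (n + 1) x _ rfl t) =
        A.map w z hwz (A.iter (n + 1) x w hw t) := by
      rintro w rfl hwz; rfl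
    exact key _ hz _

/-- The finite image subdiagrams consist of the images of the iterated structure maps. -/
theorem imgSub_natCast (A : ShiftDiagram.{u, v} R ι a) (n : ℕ) (x y : ι) (h : x + n • a = y) :
    A.imgSub n y = LinearMap.range (A.iter n x y h) := by
  induction n generalizing y with
  | zero =>
    obtain rfl : x = y := by simpa using h
    have h1 : A.imgSub ((0 : ℕ) : Ordinal.{v}) x = ⊤ := by
      simp only [imgSub, Nat.cast_zero, OrdinalApprox.gfpApprox_zero]; rfl
    rw [h1]
    exact LinearMap.range_id.symm
  | succ n ih =>
    have hs : A.imgSub ((n + 1 : ℕ) : Ordinal.{v}) y = A.imgOp (A.imgSub n) y := by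
      have := OrdinalApprox.gfpApprox_add_one A.imgOp (x := ⊤) le_top (n : Ordinal.{v})
      rw [imgSub, Nat.cast_add, Nat.cast_one, this]; rfl
    rw [hs]
    have hx : x + n • a = y - a := by rw [← h, succ_nsmul]; abel
    change (A.imgSub n (y - a)).map (A.map (y - a) y _) = _
    rw [ih (y - a) hx, ← LinearMap.range_comp]
    have key : ∀ (w : ι) (hw : x + n • a = w) (hwy : w + a = y),
        LinearMap.range (A.map w y hwy ∘ₗ A.iter n x w hw) =
          LinearMap.range (A.iter (n + 1) x y h) := by
      rintro w rfl hwy; rfl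
    exact key _ hx _

/-- The projection to a finite image quotient diagram is the iterated structure map onto its
image. -/
theorem quoKer_natCast (A : ShiftDiagram.{u, v} R ι a) (n : ℕ) (x y : ι) (h : x + n • a = y) :
    A.quoKer n x = LinearMap.ker (A.iter n x y h) := by
  induction n generalizing x with
  | zero =>
    obtain rfl : x = y := by simpa using h
    have h1 : A.quoKer ((0 : ℕ) : Ordinal.{v}) x = ⊥ := by
      simp only [quoKer, Nat.cast_zero, OrdinalApprox.lfpApprox_zero]; rfl
    rw [h1]
    exact LinearMap.ker_id.symm
  | succ n ih =>
    have hs : A.quoKer ((n + 1 : ℕ) : Ordinal.{v}) x = A.kerOp (A.quoKer n) x := by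
      have := OrdinalApprox.lfpApprox_add_one A.kerOp (x := ⊥) bot_le (n : Ordinal.{v})
      rw [quoKer, Nat.cast_add, Nat.cast_one, this]; rfl
    have hx : x + a + n • a = y := by rw [← h, succ_nsmul]; abel
    rw [hs]
    change (A.quoKer n (x + a)).comap (A.map x (x + a) rfl) = _
    rw [ih (x + a) hx]
    ext t
    simp only [Submodule.mem_comap, LinearMap.mem_ker]
    rw [A.iter_succ' n x (x + a) y rfl hx h]

theorem ker_iter_mono (A : ShiftDiagram.{u, v} R ι a) (x : ι) :
    Monotone fun n : ℕ => LinearMap.ker (A.iter n x (x + n • a) rfl) := by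
  refine monotone_nat_of_le_succ fun n t ht => ?_
  rw [LinearMap.mem_ker] at ht ⊢
  change A.map _ _ _ (A.iter n x (x + n • a) rfl t) = 0
  rw [ht, map_zero]

/-- The image quotient diagrams are stable from the first infinite ordinal on. -/
theorem quoKer_stabOrd_le (A : ShiftDiagram.{u, v} R ι a) (x : ι) :
    A.quoKer A.stabOrd x ≤ ⨆ n : ℕ, LinearMap.ker (A.iter n x (x + n • a) rfl) := by
  refine OrdinalApprox.lfpApprox_le_of_mem_fixedPoints A.kerOp (a := fun x =>
    ⨆ n : ℕ, LinearMap.ker (A.iter n x (x + n • a) rfl)) ?_ bot_le _ x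
  funext x
  apply le_antisymm
  · intro t ht
    change A.map x (x + a) rfl t ∈ (⨆ n : ℕ, LinearMap.ker (A.iter n (x + a) _ rfl) :
      Submodule R (A.obj (x + a))) at ht
    rw [Submodule.mem_iSup_of_directed _ (A.ker_iter_mono (x + a)).directed_le] at ht
    obtain ⟨n, hn⟩ := ht
    refine Submodule.mem_iSup_of_mem (n + 1) ?_
    have hz : x + a + n • a = x + (n + 1) • a := by rw [succ_nsmul]; abel
    rw [LinearMap.mem_ker] at hn ⊢
    rw [A.iter_succ' n x (x + a) (x + (n + 1) • a) rfl hz rfl]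
    have key : ∀ (w : ι) (hw : x + a + n • a = w),
        A.iter n (x + a) w hw (A.map x (x + a) rfl t) = 0 := by
      rintro w rfl; exact hn
    exact key _ hz
  · rw [iSup_le_iff]
    intro n t ht
    have ht' := A.ker_iter_mono x n.le_succ ht
    change A.map x (x + a) rfl t ∈ (⨆ n : ℕ, LinearMap.ker (A.iter n (x + a) _ rfl) :
      Submodule R (A.obj (x + a)))
    refine Submodule.mem_iSup_of_mem n ?_
    have hz : x + (n + 1) • a = x + a + n • a := by rw [succ_nsmul]; abel
    change A.iter (n + 1) x _ rfl t = 0 at ht'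
    rw [LinearMap.mem_ker, ← A.iter_succ' n x (x + a) (x + a + n • a) rfl rfl hz]
    have key : ∀ (w : ι) (hw : x + (n + 1) • a = w), A.iter (n + 1) x w hw t = 0 := by
      rintro w rfl; exact ht'
    exact key _ hz

theorem Hom.comm_iter {A B : ShiftDiagram.{u, v} R ι a} (f : Hom A B) (n : ℕ) (x y : ι)
    (h : x + n • a = y) (t : A.obj x) : f.app y (A.iter n x y h t) = B.iter n x y h (f.app x t) := by
  induction n generalizing y with
  | zero =>
    obtain rfl : x = y := by simpa using h
    rfl
  | succ n ih =>
    change f.app y (A.map _ y _ (A.iter n x _ rfl t)) = B.map _ y _ (B.iter n x _ rfl (f.app x t))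
    rw [f.comm, ih]

/-- The integer-indexed diagram `⋯ → A (x - a) → A x → A (x + a) → ⋯` through position `x`. -/
def line (A : ShiftDiagram.{u, v} R ι a) (x : ι) : ZDiagram.{u, v} R where
  obj p := A.obj (x + p • a)
  map p q h := A.map (x + p • a) (x + q • a) (by rw [← h, add_smul, one_smul, add_assoc])

/-- The restriction of a morphism of diagrams to the line through `x`. -/
def Hom.line {A B : ShiftDiagram.{u, v} R ι a} (f : Hom A B) (x : ι) :
    Hom (A.line x) (B.line x) where
  app p := f.app (x + p • a)
  comm p q _ t := f.comm (x + p • a) (x + q • a) _ t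

end General

/-! ### Limits, `lim¹` and colimits of integer-indexed diagrams -/

section ZDiagrams

variable {R : Type u} [Ring R]

/-- The map `∏ A p → ∏ A q` whose `q`-th coordinate sends `s` to `s q - a (s (q - 1))`. -/
def diff (A : ZDiagram.{u, v} R) : (∀ p, A.obj p) →ₗ[R] (∀ p, A.obj p) :=
  LinearMap.pi fun q => LinearMap.proj (φ := fun p => A.obj p) q -
    A.map (q - 1) q (sub_add_cancel q 1) ∘ₗ LinearMap.proj (φ := fun p => A.obj p) (q - 1)

/-- The limit of a diagram: the module of compatible families. -/
def lim (A : ZDiagram.{u, v} R) : Submodule R (∀ p, A.obj p) := LinearMap.ker A.diff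

/-- The limit cone. -/
def limProj (A : ZDiagram.{u, v} R) (p : ℤ) : A.lim →ₗ[R] A.obj p :=
  LinearMap.proj p ∘ₗ A.lim.subtype

/-- The first derived limit of a diagram. -/
abbrev lim1 (A : ZDiagram.{u, v} R) : Type v := (∀ p, A.obj p) ⧸ LinearMap.range A.diff

/-- The transition maps of a diagram between positions `p ≤ q`. -/
def trans (A : ZDiagram.{u, v} R) (p q : ℤ) (h : p ≤ q) : A.obj p →ₗ[R] A.obj q :=
  A.iter (q - p).toNat p q (by simp; omega)

/-- The colimit of a diagram. -/
abbrev colim (A : ZDiagram.{u, v} R) : Type v :=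
  Module.DirectLimit (fun p => A.obj p) A.trans

/-- The colimit cocone. -/
def colimIncl (A : ZDiagram.{u, v} R) (p : ℤ) : A.obj p →ₗ[R] A.colim :=
  Module.DirectLimit.of R ℤ (fun p => A.obj p) A.trans p

/-- The image filtration of the colimit: the images of the maps of the colimit cocone. -/
def imFil (A : ZDiagram.{u, v} R) (p : ℤ) : Submodule R A.colim :=
  LinearMap.range (A.colimIncl p)

/-- The kernel filtration of the limit: the kernels of the maps of the limit cone. -/
def kerFil (A : ZDiagram.{u, v} R) (p : ℤ) : Submodule R A.lim :=
  LinearMap.ker (A.limProj p)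

/-- The quotient of the image filtration in position `p` by the preceding stage. -/
abbrev imGr (A : ZDiagram.{u, v} R) (p : ℤ) : Type v := Subquot (A.imFil p) (A.imFil (p - 1))

/-- The quotient of the kernel filtration in position `p + 1` by the preceding stage. -/
abbrev kerGr (A : ZDiagram.{u, v} R) (p : ℤ) : Type v := Subquot (A.kerFil (p + 1)) (A.kerFil p)

theorem trans_of_add_one (A : ZDiagram.{u, v} R) (p q : ℤ) (h : p + 1 = q) (t : A.obj p) :
    A.trans p q (by omega) t = A.map p q h t := by
  have key : ∀ (n : ℕ) (hn : p + n • (1 : ℤ) = q), n = 1 → A.iter n p q hn t = A.map p q h t := by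
    rintro n hn rfl
    rw [A.iter_succ' 0 p q q h (by simp) hn]
    rfl
  exact key _ _ (by omega)

theorem colimIncl_map (A : ZDiagram.{u, v} R) (p q : ℤ) (h : p + 1 = q) (t : A.obj p) :
    A.colimIncl q (A.map p q h t) = A.colimIncl p t := by
  rw [← A.trans_of_add_one p q h]
  exact Module.DirectLimit.of_f

theorem imFil_le (A : ZDiagram.{u, v} R) (p q : ℤ) (h : p + 1 = q) : A.imFil p ≤ A.imFil q := by
  rintro _ ⟨t, rfl⟩
  exact ⟨A.map p q h t, A.colimIncl_map p q h t⟩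

/-- The image filtration of the colimit, as a diagram of submodules and inclusions. -/
def imFilDiagram (A : ZDiagram.{u, v} R) : ZDiagram.{u, v} R where
  obj p := ModuleCat.of R (A.imFil p)
  map p q h := Submodule.inclusion (A.imFil_le p q h)

/-- The canonical map from the limit to the colimit, `lim A → A 0 → colim A`. -/
def limToColim (A : ZDiagram.{u, v} R) : A.lim →ₗ[R] A.colim := A.colimIncl 0 ∘ₗ A.limProj 0

/-- The image of the canonical map from the limit to the colimit. -/
def imLim (A : ZDiagram.{u, v} R) : Submodule R A.colim := LinearMap.range A.limToColim

end ZDiagrams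

/-! ### The maps induced by a morphism of integer-indexed diagrams -/

namespace Hom

variable {R : Type u} [Ring R] {A B : ZDiagram.{u, v} R} (f : Hom A B)

/-- The induced map of products. -/
def piMap : (∀ p, A.obj p) →ₗ[R] (∀ p, B.obj p) :=
  LinearMap.pi fun p => f.app p ∘ₗ LinearMap.proj p

theorem diff_piMap (s : ∀ p, A.obj p) : B.diff (f.piMap s) = f.piMap (A.diff s) := by
  funext q
  change f.app q (s q) - B.map (q - 1) q _ (f.app (q - 1) (s (q - 1))) =
    f.app q (s q - A.map (q - 1) q _ (s (q - 1)))
  rw [map_sub, f.comm]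

/-- The induced map of limits. -/
def limMap : A.lim →ₗ[R] B.lim :=
  f.piMap.restrict fun s hs => by
    have hs' : A.diff s = 0 := hs
    change B.diff (f.piMap s) = 0
    rw [diff_piMap, hs', map_zero]

/-- The induced map of first derived limits. -/
def lim1Map : A.lim1 →ₗ[R] B.lim1 :=
  Submodule.mapQ _ _ f.piMap <| by
    rintro _ ⟨s, rfl⟩
    exact ⟨f.piMap s, f.diff_piMap s⟩

/-- The induced map of colimits. -/
def colimMap : A.colim →ₗ[R] B.colim :=
  Module.DirectLimit.map f.app fun p q h => by
    ext t
    exact f.comm_iter _ p q _ t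

theorem colimMap_colimIncl (p : ℤ) (t : A.obj p) :
    f.colimMap (A.colimIncl p t) = B.colimIncl p (f.app p t) :=
  Module.DirectLimit.map_apply_of _ _ _

theorem limProj_limMap (p : ℤ) (s : A.lim) :
    B.limProj p (f.limMap s) = f.app p (A.limProj p s) := rfl

theorem colimMap_mem_imFil (p : ℤ) : ∀ x ∈ A.imFil p, f.colimMap x ∈ B.imFil p := by
  rintro _ ⟨t, rfl⟩
  exact ⟨f.app p t, (f.colimMap_colimIncl p t).symm⟩

theorem limMap_mem_kerFil (p : ℤ) : ∀ s ∈ A.kerFil p, f.limMap s ∈ B.kerFil p := by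
  intro s hs
  have hs' : A.limProj p s = 0 := hs
  change B.limProj p (f.limMap s) = 0
  rw [limProj_limMap, hs', map_zero]

/-- The induced map of quotients of the image filtrations of the colimits. -/
def imGrMap (p : ℤ) : A.imGr p →ₗ[R] B.imGr p :=
  Subquot.map f.colimMap (f.colimMap_mem_imFil p) (f.colimMap_mem_imFil (p - 1))

/-- The induced map of quotients of the kernel filtrations of the limits. -/
def kerGrMap (p : ℤ) : A.kerGr p →ₗ[R] B.kerGr p :=
  Subquot.map f.limMap (f.limMap_mem_kerFil (p + 1)) (f.limMap_mem_kerFil p)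

/-- The induced morphism of image filtration diagrams. -/
def imFilMap : Hom A.imFilDiagram B.imFilDiagram where
  app p := f.colimMap.restrict (f.colimMap_mem_imFil p)
  comm _ _ _ _ := rfl

/-- The induced map of the images of the canonical maps from the limit to the colimit. -/
def imLimMap : A.imLim →ₗ[R] B.imLim :=
  f.colimMap.restrict <| by
    rintro _ ⟨s, rfl⟩
    exact ⟨f.limMap s, (f.colimMap_colimIncl 0 (A.limProj 0 s)).symm⟩

end Hom

end ShiftDiagram

/-! ### Bigraded exact couples -/

/-- The determinant of the matrix with columns `x` and `y`. -/
def det2 (x y : ℤ × ℤ) : ℤ := Matrix.det !![x.1, y.1; x.2, y.2]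

/-- A `(ℤ × ℤ)`-bigraded exact couple of `R`-modules whose structure maps `i : D → D`, `j : D → E`
and `k : E → D` have bidegrees `a`, `b` and `c`; the map `i` is the structure map of the diagram
`D`. -/
structure ExactCouple (R : Type u) [Ring R] (a b c : ℤ × ℤ) where
  D : ShiftDiagram.{u, v} R (ℤ × ℤ) a
  E : ℤ × ℤ → ModuleCat.{v} R
  j : ∀ x y, x + b = y → (D.obj x →ₗ[R] E y)
  k : ∀ x y, x + c = y → (E x →ₗ[R] D.obj y)
  exact_i_j : ∀ x y z (h : x + a = y) (h' : y + b = z), Function.Exact (D.map x y h) (j y z h')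
  exact_j_k : ∀ x y z (h : x + b = y) (h' : y + c = z), Function.Exact (j x y h) (k y z h')
  exact_k_i : ∀ x y z (h : x + c = y) (h' : y + a = z), Function.Exact (k x y h) (D.map y z h')

namespace ExactCouple

variable {R : Type u} [Ring R] {a b c : ℤ × ℤ}

/-- The number `σ = det [a, b + c]`. -/
def sigma (_C : ExactCouple.{u, v} R a b c) : ℤ := det2 a (b + c)

/-- An exact couple is regular if `det [a, b + c]` is `1` or `-1`. -/
def IsRegular (C : ExactCouple.{u, v} R a b c) : Prop := C.sigma = 1 ∨ C.sigma = -1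

/-- The position `x(n) = σ n (b + c)`. For a regular exact couple, the positions `x` with
`det [a, x] = n` are those of the form `x(n) + r a` with `r` an integer. -/
def base (C : ExactCouple.{u, v} R a b c) (n : ℤ) : ℤ × ℤ := (C.sigma * n) • (b + c)

/-- The diagram `⋯ → D (x(n) - a) → D (x(n)) → D (x(n) + a) → ⋯`. Its colimit and its limit are the
colimit abutment and the limit abutment of the exact couple in position `n`. -/
def diagram (C : ExactCouple.{u, v} R a b c) (n : ℤ) : ZDiagram.{u, v} R := C.D.line (C.base n)

/-- The cycles `Z^r = k⁻¹ (im i^r)` in position `y`. -/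
def cycles (C : ExactCouple.{u, v} R a b c) (r : ℕ) (y : ℤ × ℤ) : Submodule R (C.E y) :=
  (LinearMap.range (C.D.iter r (y + c - r • a) (y + c) (sub_add_cancel _ _))).comap
    (C.k y (y + c) rfl)

/-- The boundaries `B^r = j (ker i^r)` in position `y`. -/
def boundaries (C : ExactCouple.{u, v} R a b c) (r : ℕ) (y : ℤ × ℤ) : Submodule R (C.E y) :=
  (LinearMap.ker (C.D.iter r (y - b) (y - b + r • a) rfl)).map
    (C.j (y - b) y (sub_add_cancel _ _))

/-- The intersection of the cycles of all finite orders. -/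
def cyclesInfty (C : ExactCouple.{u, v} R a b c) (y : ℤ × ℤ) : Submodule R (C.E y) :=
  ⨅ r : ℕ, C.cycles r y

/-- The union of the boundaries of all finite orders. -/
def boundariesInfty (C : ExactCouple.{u, v} R a b c) (y : ℤ × ℤ) : Submodule R (C.E y) :=
  ⨆ r : ℕ, C.boundaries r y

/-- The page `E^{r+1} = Z^r / B^r` of the spectral sequence of the exact couple, in position `y`. -/
abbrev page (C : ExactCouple.{u, v} R a b c) (r : ℕ) (y : ℤ × ℤ) : Type v :=
  Subquot (C.cycles r y) (C.boundaries r y)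

/-- The limit page `E^∞` of the spectral sequence of the exact couple, in position `y`. -/
abbrev EInfty (C : ExactCouple.{u, v} R a b c) (y : ℤ × ℤ) : Type v :=
  Subquot (C.cyclesInfty y) (C.boundariesInfty y)

/-- A class is a cycle for the differential of the page `E^{r+1}` if and only if it comes from
`Z^{r+1}`; the differential sends the class of `e ∈ Z^r` to the class of `j t` for any `t` with
`i^r t = k e`. -/
theorem mem_cycles_succ (C : ExactCouple.{u, v} R a b c) (r : ℕ) (y x z : ℤ × ℤ)
    (h : x + r • a = y + c) (h' : x + b = z) (e : C.E y) :
    e ∈ C.cycles (r + 1) y ↔ ∃ t : C.D.obj x,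
      C.D.iter r x (y + c) h t = C.k y (y + c) rfl e ∧ C.j x z h' t ∈ C.boundaries r z := by
  have hx : x - a + a = x := sub_add_cancel x a
  have h1 : x - a + (r + 1) • a = y + c := by rw [← h, succ_nsmul]; abel
  have hc : e ∈ C.cycles (r + 1) y ↔
      C.k y (y + c) rfl e ∈ LinearMap.range (C.D.iter (r + 1) (x - a) (y + c) h1) := by
    rw [cycles, Submodule.mem_comap, ← C.D.imgSub_natCast, ← C.D.imgSub_natCast]
  have hb : C.boundaries r z = (LinearMap.ker (C.D.iter r x (y + c) h)).map (C.j x z h') := by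
    obtain rfl : x = z - b := by rw [← h', add_sub_cancel_right]
    rw [boundaries, ← C.D.quoKer_natCast, ← C.D.quoKer_natCast]
  rw [hc, hb]
  constructor
  · rintro ⟨s, hs⟩
    refine ⟨C.D.map (x - a) x hx s, ?_, ?_⟩
    · rw [← C.D.iter_succ' r (x - a) x (y + c) hx h h1, hs]
    · rw [(C.exact_i_j _ _ _ hx h').apply_apply_eq_zero]
      exact zero_mem _
  · rintro ⟨t, ht, u, hu, htu⟩
    have hu' : C.D.iter r x (y + c) h u = 0 := hu
    obtain ⟨s, hs⟩ := (C.exact_i_j _ _ _ hx h' (t - u)).1 (by rw [map_sub, htu, sub_self])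
    refine ⟨s, ?_⟩
    rw [C.D.iter_succ' r (x - a) x (y + c) hx h h1, hs, map_sub, hu', sub_zero, ht]

/-- A class of the page `E^{r+1}` is a boundary for the differential of this page if and only if it
comes from `B^{r+1}`. -/
theorem mem_boundaries_succ (C : ExactCouple.{u, v} R a b c) (r : ℕ) (y x z : ℤ × ℤ)
    (h : x + r • a = y + c) (h' : x + b = z) (e : C.E z) :
    e ∈ C.boundaries (r + 1) z ↔ ∃ (e' : C.E y) (t : C.D.obj x),
      C.D.iter r x (y + c) h t = C.k y (y + c) rfl e' ∧ e - C.j x z h' t ∈ C.boundaries r z := by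
  have hb : C.boundaries r z = (LinearMap.ker (C.D.iter r x (y + c) h)).map (C.j x z h') := by
    obtain rfl : x = z - b := by rw [← h', add_sub_cancel_right]
    rw [boundaries, ← C.D.quoKer_natCast, ← C.D.quoKer_natCast]
  have h1 : x + (r + 1) • a = y + c + a := by rw [← h, succ_nsmul]; abel
  have hb1 : C.boundaries (r + 1) z =
      (LinearMap.ker (C.D.iter (r + 1) x (y + c + a) h1)).map (C.j x z h') := by
    obtain rfl : x = z - b := by rw [← h', add_sub_cancel_right]
    rw [boundaries, ← C.D.quoKer_natCast, ← C.D.quoKer_natCast]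
  have hit : ∀ t, C.D.iter (r + 1) x (y + c + a) h1 t =
      C.D.map (y + c) (y + c + a) rfl (C.D.iter r x (y + c) h t) := by
    intro t
    have key : ∀ w (hw : x + r • a = w) (hw' : w + a = y + c + a),
        C.D.iter (r + 1) x (y + c + a) h1 t = C.D.map w _ hw' (C.D.iter r x w hw t) := by
      rintro w rfl hw'; rfl
    exact key _ h rfl
  rw [hb, hb1]
  constructor
  · rintro ⟨t, ht, rfl⟩
    have ht' : C.D.iter (r + 1) x (y + c + a) h1 t = 0 := ht
    rw [hit] at ht'
    obtain ⟨e', he'⟩ := (C.exact_k_i y _ _ rfl rfl _).1 ht'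
    refine ⟨e', t, he'.symm, ?_⟩
    rw [sub_self]
    exact zero_mem _
  · rintro ⟨e', t, ht, u, hu, htu⟩
    have hu' : C.D.iter r x (y + c) h u = 0 := hu
    refine ⟨t + u, ?_, by rw [map_add, htu]; abel⟩
    change C.D.iter (r + 1) x (y + c + a) h1 (t + u) = 0
    rw [hit, map_add, hu', add_zero, ht]
    exact (C.exact_k_i y _ _ rfl rfl).apply_apply_eq_zero e'

/-- The cycles `Z^τ = k⁻¹ (I^τ D)` of order `τ`, for an ordinal `τ`. -/
def cyclesOrd (C : ExactCouple.{u, v} R a b c) (τ : Ordinal.{v}) (y : ℤ × ℤ) :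
    Submodule R (C.E y) :=
  (C.D.imgSub τ (y + c)).comap (C.k y (y + c) rfl)

/-- The boundaries `B^τ = j (ker (D → Q^τ D))` of order `τ`, for an ordinal `τ`. -/
def boundariesOrd (C : ExactCouple.{u, v} R a b c) (τ : Ordinal.{v}) (y : ℤ × ℤ) :
    Submodule R (C.E y) :=
  (C.D.quoKer τ (y - b)).map (C.j (y - b) y (sub_add_cancel _ _))

/-- The stable object in position `y`: the object `E^{α+1} = Z^α / B^α` for an ordinal `α` from
which on the transfinite sequence of these objects is constant. -/
abbrev EStable (C : ExactCouple.{u, v} R a b c) (y : ℤ × ℤ) : Type v :=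
  Subquot (C.cyclesOrd C.D.stabOrd y) (C.boundariesOrd C.D.stabOrd y)

theorem cyclesOrd_natCast (C : ExactCouple.{u, v} R a b c) (r : ℕ) (y : ℤ × ℤ) :
    C.cyclesOrd r y = C.cycles r y := by
  rw [cyclesOrd, cycles, C.D.imgSub_natCast]

theorem boundariesOrd_natCast (C : ExactCouple.{u, v} R a b c) (r : ℕ) (y : ℤ × ℤ) :
    C.boundariesOrd r y = C.boundaries r y := by
  rw [boundariesOrd, boundaries, C.D.quoKer_natCast]

theorem cyclesOrd_stabOrd_le (C : ExactCouple.{u, v} R a b c) (y : ℤ × ℤ) :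
    C.cyclesOrd C.D.stabOrd y ≤ C.cyclesInfty y := by
  refine le_iInf fun r => ?_
  rw [← cyclesOrd_natCast]
  exact Submodule.comap_mono (C.D.imgSub_stabOrd_le r (y + c))

theorem boundariesOrd_stabOrd_le (C : ExactCouple.{u, v} R a b c) (y : ℤ × ℤ) :
    C.boundariesOrd C.D.stabOrd y ≤ C.boundariesInfty y := by
  refine (Submodule.map_mono (C.D.quoKer_stabOrd_le (y - b))).trans ?_
  rw [Submodule.map_iSup]
  exact le_rfl

/-- The canonical map from the stable object to the limit page of the spectral sequence. -/
def stableToInfty (C : ExactCouple.{u, v} R a b c) (y : ℤ × ℤ) : C.EStable y →ₗ[R] C.EInfty y :=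
  Subquot.map LinearMap.id (fun _ h => C.cyclesOrd_stabOrd_le y h)
    (fun _ h => C.boundariesOrd_stabOrd_le y h)

/-- The object `E^∞` in position `y` is stable if the canonical map from the stable object to it is
an isomorphism. -/
def IsStableAt (C : ExactCouple.{u, v} R a b c) (y : ℤ × ℤ) : Prop :=
  Function.Bijective (C.stableToInfty y)

/-- Morphisms of exact couples with the same bidegrees: families of linear maps on the objects of
`D` and of `E` that commute with `i`, `j` and `k`. -/
structure Hom (C₁ C₂ : ExactCouple.{u, v} R a b c) where
  onD : ShiftDiagram.Hom C₁.D C₂.D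
  onE : ∀ x, C₁.E x →ₗ[R] C₂.E x
  comm_j : ∀ x y (h : x + b = y) (t : C₁.D.obj x), onE y (C₁.j x y h t) = C₂.j x y h (onD.app x t)
  comm_k : ∀ x y (h : x + c = y) (e : C₁.E x), onD.app y (C₁.k x y h e) = C₂.k x y h (onE x e)

namespace Hom

variable {C₁ C₂ : ExactCouple.{u, v} R a b c} (f : Hom C₁ C₂)

/-- The induced morphism of the diagrams in position `n`. -/
def diagramMap (n : ℤ) : ShiftDiagram.Hom (C₁.diagram n) (C₂.diagram n) :=
  f.onD.line (C₁.base n)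

theorem onE_mem_cycles (r : ℕ) (y : ℤ × ℤ) : ∀ e ∈ C₁.cycles r y, f.onE y e ∈ C₂.cycles r y := by
  rintro e ⟨t, ht⟩
  refine ⟨f.onD.app _ t, ?_⟩
  rw [← f.onD.comm_iter, ht, f.comm_k]

theorem onE_mem_boundaries (r : ℕ) (y : ℤ × ℤ) :
    ∀ e ∈ C₁.boundaries r y, f.onE y e ∈ C₂.boundaries r y := by
  rintro _ ⟨t, ht, rfl⟩
  have ht' : C₁.D.iter r _ _ _ t = 0 := ht
  refine ⟨f.onD.app _ t, ?_, (f.comm_j _ _ _ t).symm⟩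
  change C₂.D.iter r _ _ _ (f.onD.app _ t) = 0
  rw [← f.onD.comm_iter, ht', map_zero]

/-- The induced map `f^∞` of the limit pages of the spectral sequences. -/
def inftyMap (y : ℤ × ℤ) : C₁.EInfty y →ₗ[R] C₂.EInfty y :=
  Subquot.map (f.onE y)
    (fun e he => by
      rw [cyclesInfty, Submodule.mem_iInf] at he ⊢
      exact fun r => f.onE_mem_cycles r y e (he r))
    (fun e he => by
      have hle : C₁.boundariesInfty y ≤ (C₂.boundariesInfty y).comap (f.onE y) :=
        iSup_le fun r e he =>
          Submodule.mem_iSup_of_mem r (f.onE_mem_boundaries r y e he)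
      exact hle he)

end Hom

end ExactCouple

end ExactCouples

end

/-! Write `A` for the diagram through `x(n)` and `D` for the one through `x(n + σ)`. Regularity
makes the exact couple connect them by exact sequences `A (p-1) → A p → E → D p → D (p+1)`.

The stable image of `D` consists of the elements that extend to compatible families, and the stable
kernels of `A` are the kernels of the maps to the colimit (`imgSub_stabOrd_eq_range`,
`quoKer_stabOrd_eq_ker`). Hence the stable subquotient of `E` is an extension of the
kernel-filtration quotient of `lim D` by the image-filtration quotient of `colim A`. If the map of
the middle terms is bijective, the map of the subobjects is injective and that of the quotients is
surjective; each of the two remaining properties implies the other (`bijective_gr`). The either-or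
hypothesis thus gives isomorphisms of all graded pieces on both sides.

It remains to pass from graded pieces to abutments. The image filtration exhausts the colimit, but
need be neither Hausdorff nor complete; its `lim` and `lim¹` control these defects
(`colimMap_injective`, `colimMap_surjective`). The kernel filtration of the limit is Hausdorff and
complete, but its union is only the kernel of `lim → colim`; the image of that map accounts for the
rest (`limMap_injective`, `limMap_surjective`). -/

namespace ExactCouples

/-! ### Elementwise criteria for maps of subquotients. -/

section Subquotients

variable {R : Type u} [Ring R] {M N : Type v} [AddCommGroup M] [Module R M]
  [AddCommGroup N] [Module R N]

theorem Subquot.mk_eq_zero_iff {Z B : Submodule R M} (x : Z) :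
    (Submodule.Quotient.mk x : Subquot Z B) = 0 ↔ x.1 ∈ B :=
  Submodule.Quotient.mk_eq_zero _

theorem Subquot.mk_eq_mk_iff {Z B : Submodule R M} (x y : Z) :
    (Submodule.Quotient.mk x : Subquot Z B) = Submodule.Quotient.mk y ↔ x.1 - y.1 ∈ B :=
  Submodule.Quotient.eq _

/-- This criterion and its surjective counterpart reduce all later arguments to chases in the
ambient modules; neither needs the inclusion of `B` in `Z`. -/
theorem Subquot.map_injective_iff {Z B : Submodule R M} {Z' B' : Submodule R N} (f : M →ₗ[R] N)
    (hZ : ∀ x ∈ Z, f x ∈ Z') (hB : ∀ x ∈ B, f x ∈ B') :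
    Function.Injective (Subquot.map f hZ hB) ↔ ∀ x ∈ Z, f x ∈ B' → x ∈ B := by
  rw [injective_iff_map_eq_zero]
  constructor
  · intro h x hx hfx
    exact (Subquot.mk_eq_zero_iff ⟨x, hx⟩).1
      (h (Submodule.Quotient.mk ⟨x, hx⟩) ((Subquot.mk_eq_zero_iff ⟨f x, hZ x hx⟩).2 hfx))
  · intro h x
    obtain ⟨x, rfl⟩ := Submodule.Quotient.mk_surjective _ x
    intro hx
    exact (Subquot.mk_eq_zero_iff x).2
      (h x.1 x.2 ((Subquot.mk_eq_zero_iff ⟨f x.1, hZ x.1 x.2⟩).1 hx))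

theorem Subquot.map_surjective_iff {Z B : Submodule R M} {Z' B' : Submodule R N} (f : M →ₗ[R] N)
    (hZ : ∀ x ∈ Z, f x ∈ Z') (hB : ∀ x ∈ B, f x ∈ B') :
    Function.Surjective (Subquot.map f hZ hB) ↔ ∀ y ∈ Z', ∃ x ∈ Z, f x - y ∈ B' := by
  constructor
  · intro h y hy
    obtain ⟨x, hx⟩ := h (Submodule.Quotient.mk ⟨y, hy⟩)
    obtain ⟨x, rfl⟩ := Submodule.Quotient.mk_surjective _ x
    exact ⟨x.1, x.2, (Subquot.mk_eq_mk_iff ⟨f x.1, hZ x.1 x.2⟩ ⟨y, hy⟩).1 hx⟩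
  · intro h y
    obtain ⟨y, rfl⟩ := Submodule.Quotient.mk_surjective _ y
    obtain ⟨x, hx, hxy⟩ := h y.1 y.2
    exact ⟨Submodule.Quotient.mk ⟨x, hx⟩, (Subquot.mk_eq_mk_iff ⟨f x, hZ x hx⟩ y).2 hxy⟩

end Subquotients

namespace ShiftDiagram

/-! ### Iterated structure maps and the stable stages. -/

section General

variable {R : Type u} [Ring R] {ι : Type} [AddCommGroup ι] {a : ι}

theorem iter_iter (A : ShiftDiagram.{u, v} R ι a) (m n k : ℕ) (x y z : ι) (h : x + m • a = y)
    (h' : y + n • a = z) (h'' : x + k • a = z) (hk : m + n = k) (t : A.obj x) :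
    A.iter n y z h' (A.iter m x y h t) = A.iter k x z h'' t := by
  subst hk
  induction m generalizing x with
  | zero =>
    obtain rfl : x = y := by simpa using h
    -- The exponent becomes a variable so that an equality that is not definitional can be
    -- substituted; the other `key` statements about iterates use the same device.
    have key : ∀ (k : ℕ) (hk : n = k) (hz : x + k • a = z),
        A.iter n x z h' t = A.iter k x z hz t := by rintro k rfl hz; rfl
    exact key _ (Nat.zero_add n).symm _
  | succ m ih =>
    have h1 : x + a + m • a = y := by rw [← h, succ_nsmul]; abel
    have h2 : x + a + (m + n) • a = z := by rw [← h', ← h1, add_smul]; abel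
    have h3 : x + (m + n + 1) • a = z := by rw [← h2, succ_nsmul]; abel
    rw [A.iter_succ' m x (x + a) y rfl h1 h, ih (x + a) h1 _ h2,
      ← A.iter_succ' (m + n) x (x + a) z rfl h2 h3]
    have key : ∀ (k : ℕ) (hk : m + n + 1 = k) (hz : x + k • a = z),
        A.iter (m + n + 1) x z h3 t = A.iter k x z hz t := by rintro k rfl hz; rfl
    exact key _ (by omega) _

theorem iter_eq_zero_of_eq (A : ShiftDiagram.{u, v} R ι a) {m n : ℕ} {x y z : ι}
    (h : x + m • a = y) (h' : x + n • a = z) (hmn : m = n) {t : A.obj x}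
    (ht : A.iter m x y h t = 0) : A.iter n x z h' t = 0 := by
  subst hmn
  obtain rfl : y = z := h.symm.trans h'
  exact ht

theorem line_iter (A : ShiftDiagram.{u, v} R ι a) (x : ι) (n : ℕ) (p q : ℤ)
    (h : p + n • (1 : ℤ) = q) (h' : x + p • a + n • a = x + q • a) (t : (A.line x).obj p) :
    (A.line x).iter n p q h t = A.iter n (x + p • a) (x + q • a) h' t := by
  induction n generalizing p with
  | zero =>
    obtain rfl : p = q := by simpa using h
    rfl
  | succ n ih =>
    have h1 : p + 1 + n • (1 : ℤ) = q := by rw [← h, succ_nsmul]; abel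
    have h2 : x + p • a + a = x + (p + 1) • a := by rw [add_smul, one_smul, add_assoc]
    have h3 : x + (p + 1) • a + n • a = x + q • a := by rw [← h', ← h2, succ_nsmul]; abel
    exact ((A.line x).iter_succ' n p (p + 1) q rfl h1 h t).trans ((ih (p + 1) h1 h3 _).trans
      (A.iter_succ' n (x + p • a) (x + (p + 1) • a) (x + q • a) h2 h3 h' t).symm)

/-- The stable image subdiagram is carried onto itself by the structure maps. -/
theorem imgSub_stabOrd_map (A : ShiftDiagram.{u, v} R ι a) (x y : ι) (h : x + a = y) :
    (A.imgSub A.stabOrd x).map (A.map x y h) = A.imgSub A.stabOrd y := by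
  have hfix := congrFun (OrdinalApprox.gfpApprox_ord_mem_fixedPoint A.imgOp (x := ⊤) le_top) y
  obtain rfl : x = y - a := by rw [← h, add_sub_cancel_right]
  exact hfix

theorem ker_iter_le_quoKer_stabOrd (A : ShiftDiagram.{u, v} R ι a) (n : ℕ) (x y : ι)
    (h : x + n • a = y) : LinearMap.ker (A.iter n x y h) ≤ A.quoKer A.stabOrd x := by
  rw [← A.quoKer_natCast]
  exact OrdinalApprox.lfpApprox_le_of_mem_fixedPoints A.kerOp
    (OrdinalApprox.lfpApprox_ord_mem_fixedPoint A.kerOp bot_le) bot_le _ x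

theorem mem_quoKer_stabOrd (A : ShiftDiagram.{u, v} R ι a) (x : ι) (t : A.obj x) :
    t ∈ A.quoKer A.stabOrd x ↔ ∃ n : ℕ, A.iter n x (x + n • a) rfl t = 0 := by
  constructor
  · intro ht
    have := A.quoKer_stabOrd_le x ht
    rwa [Submodule.mem_iSup_of_directed _ (A.ker_iter_mono x).directed_le] at this
  · rintro ⟨n, hn⟩
    exact A.ker_iter_le_quoKer_stabOrd n x _ rfl hn

end General

/-! ### Elements of limits and colimits of integer-indexed diagrams. -/

section ZDiagrams

variable {R : Type u} [Ring R]

theorem trans_self (A : ZDiagram.{u, v} R) (p : ℤ) (t : A.obj p) : A.trans p p le_rfl t = t := by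
  have key : ∀ (n : ℕ) (hn : p + n • (1 : ℤ) = p), n = 0 → A.iter n p p hn t = t := by
    rintro n hn rfl; rfl
  exact key _ _ (by simp)

theorem trans_trans (A : ZDiagram.{u, v} R) (p q r : ℤ) (h : p ≤ q) (h' : q ≤ r) (t : A.obj p) :
    A.trans q r h' (A.trans p q h t) = A.trans p r (h.trans h') t :=
  A.iter_iter _ _ _ _ _ _ _ _ _ (by omega) t

/-- Functoriality of the transition maps is what lets `Module.DirectLimit.of.zero_exact` detect
vanishing in the colimit at a finite stage. -/
instance directedSystem_trans (A : ZDiagram.{u, v} R) :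
    DirectedSystem (fun p => A.obj p) (A.trans · · ·) where
  map_self p t := A.trans_self p t
  map_map r q p h h' t := A.trans_trans p q r h h' t

theorem colimIncl_trans (A : ZDiagram.{u, v} R) (p q : ℤ) (h : p ≤ q) (t : A.obj p) :
    A.colimIncl q (A.trans p q h t) = A.colimIncl p t :=
  Module.DirectLimit.of_f

theorem colimIncl_eq_zero_iff (A : ZDiagram.{u, v} R) (p : ℤ) (t : A.obj p) :
    A.colimIncl p t = 0 ↔ ∃ q, ∃ h : p ≤ q, A.trans p q h t = 0 := by
  constructor
  · exact fun h => Module.DirectLimit.of.zero_exact h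
  · rintro ⟨q, h, ht⟩
    rw [← A.colimIncl_trans p q h, ht, map_zero]

theorem exists_mem_imFil (A : ZDiagram.{u, v} R) (x : A.colim) : ∃ p, x ∈ A.imFil p := by
  obtain ⟨p, t, rfl⟩ := Module.DirectLimit.exists_of x
  exact ⟨p, t, rfl⟩

theorem monotone_imFil (A : ZDiagram.{u, v} R) : Monotone A.imFil :=
  monotone_int_of_le_succ fun p => A.imFil_le p (p + 1) rfl

theorem mem_lim (A : ZDiagram.{u, v} R) (s : ∀ p, A.obj p) :
    s ∈ A.lim ↔ ∀ p q (h : p + 1 = q), A.map p q h (s p) = s q := by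
  constructor
  · intro hs p q h
    have := congrFun (show A.diff s = 0 from hs) q
    obtain rfl : p = q - 1 := by omega
    exact (sub_eq_zero.1 this).symm
  · intro hs
    change A.diff s = 0
    funext q
    exact sub_eq_zero.2 (hs (q - 1) q _).symm

theorem map_limProj (A : ZDiagram.{u, v} R) (s : A.lim) (p q : ℤ) (h : p + 1 = q) :
    A.map p q h (A.limProj p s) = A.limProj q s :=
  (A.mem_lim s.1).1 s.2 p q h

theorem monotone_kerFil (A : ZDiagram.{u, v} R) : Monotone A.kerFil := by
  refine monotone_int_of_le_succ fun p s hs => ?_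
  have hs' : A.limProj p s = 0 := hs
  change A.limProj (p + 1) s = 0
  rw [← A.map_limProj s p (p + 1) rfl, hs', map_zero]

theorem trans_limProj (A : ZDiagram.{u, v} R) (s : A.lim) (p q : ℤ) (h : p ≤ q) :
    A.trans p q h (A.limProj p s) = A.limProj q s := by
  induction q, h using Int.leInduction with
  | base => exact A.trans_self p _
  | succ q h ih =>
    rw [← A.map_limProj s q (q + 1) rfl, ← ih, ← A.trans_of_add_one q (q + 1) rfl, A.trans_trans]

theorem limToColim_eq (A : ZDiagram.{u, v} R) (s : A.lim) (p : ℤ) :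
    A.limToColim s = A.colimIncl p (A.limProj p s) := by
  change A.colimIncl 0 (A.limProj 0 s) = _
  rcases le_total 0 p with h | h
  · rw [← A.trans_limProj s 0 p h, A.colimIncl_trans]
  · rw [← A.trans_limProj s p 0 h, A.colimIncl_trans]

/-- A coordinate that dies in the colimit already dies at a finite stage. So the kernel filtration
exhausts only the kernel of `lim → colim`. -/
theorem limToColim_eq_zero_iff (A : ZDiagram.{u, v} R) (s : A.lim) :
    A.limToColim s = 0 ↔ ∃ p, s ∈ A.kerFil p := by
  constructor
  · intro h
    obtain ⟨q, h, hq⟩ := (A.colimIncl_eq_zero_iff 0 _).1 h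
    exact ⟨q, (A.trans_limProj s 0 q h).symm.trans hq⟩
  · rintro ⟨p, hp⟩
    have hp' : A.limProj p s = 0 := hp
    rw [A.limToColim_eq s p, hp', map_zero]

/-- In a diagram of submodules with surjective structure maps, every element extends to a
compatible family. -/
theorem exists_limProj_eq (A : ZDiagram.{u, v} R) (S : ∀ p, Submodule R (A.obj p))
    (hS : ∀ p q (h : p + 1 = q), S q ≤ (S p).map (A.map p q h)) (p : ℤ) (t : A.obj p)
    (ht : t ∈ S p) : ∃ s : A.lim, A.limProj p s = t := by
  have hsub : ∀ k : ℕ, p - (k + 1 : ℕ) + 1 = p - k := fun k => by push_cast; ring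
  have step : ∀ (k : ℕ) (t : S (p - k)), ∃ t' : S (p - (k + 1 : ℕ)),
      A.map (p - (k + 1 : ℕ)) (p - k) (hsub k) t'.1 = t.1 := by
    intro k t
    obtain ⟨t', ht', h⟩ := hS _ _ (hsub k) t.2
    exact ⟨⟨t', ht'⟩, h⟩
  choose prev hprev using step
  -- The recursion starts at index `p - 0`, so `t` is first carried there.
  obtain ⟨t₀, ht₀⟩ : ∃ t₀ : S (p - (0 : ℕ)), A.trans (p - (0 : ℕ)) p (by simp) t₀.1 = t := by
    have key : ∀ (q : ℤ) (h : q = p), ∃ t₀ : S q, A.trans q p h.le t₀.1 = t := by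
      rintro q rfl
      exact ⟨⟨t, ht⟩, A.trans_self q t⟩
    exact key _ (by simp)
  let g : ∀ k : ℕ, S (p - k) := fun k => Nat.rec t₀ prev k
  have hg : ∀ k, A.map (p - (k + 1 : ℕ)) (p - k) (hsub k) (g (k + 1)).1 = (g k).1 :=
    fun k => hprev k (g k)
  have hg' : ∀ (k : ℕ) (q : ℤ) (h : p - k ≤ q),
      A.trans (p - (k + 1 : ℕ)) q (by push_cast; omega) (g (k + 1)).1 =
        A.trans (p - k) q h (g k).1 := by
    intro k q h
    rw [← hg k, ← A.trans_of_add_one _ _ (hsub k), A.trans_trans]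
  -- Coordinate `q` will be pushed forward from `p - (p - q).toNat`; truncation makes this position
  -- `p` whenever `q ≥ p`.
  have hle : ∀ q : ℤ, p - ((p - q).toNat : ℕ) ≤ q := fun q => by omega
  have hind : ∀ (q : ℤ) (k l : ℕ) (hk : p - k ≤ q) (hl : p - l ≤ q), k ≤ l →
      A.trans (p - l) q hl (g l).1 = A.trans (p - k) q hk (g k).1 := by
    intro q k l hk hl hkl
    induction l, hkl using Nat.le_induction with
    | base => rfl
    | succ l hkl ih => rw [hg' l q (by omega), ih (by omega)]
  refine ⟨⟨fun q => A.trans (p - ((p - q).toNat : ℕ)) q (hle q) (g (p - q).toNat).1, ?_⟩, ?_⟩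
  · rw [mem_lim]
    intro q r h
    rw [← A.trans_of_add_one q r h, A.trans_trans]
    exact hind r _ _ _ _ (by omega)
  · change A.trans (p - ((p - p).toNat : ℕ)) p _ (g (p - p).toNat).1 = t
    rw [hind p 0 _ (by simp) _ (Nat.zero_le _)]
    exact ht₀

end ZDiagrams

/-! ### Stable stages in terms of limit and colimit. -/

section Line

variable {R : Type u} [Ring R] {ι : Type} [AddCommGroup ι] {a : ι}

/-- The stable image subdiagram consists of the images of the maps of the limit cone. -/
theorem imgSub_stabOrd_eq_range (A : ShiftDiagram.{u, v} R ι a) (x : ι) (p : ℤ) :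
    A.imgSub A.stabOrd (x + p • a) = LinearMap.range ((A.line x).limProj p) := by
  have hstep : ∀ p q : ℤ, p + 1 = q → x + p • a + a = x + q • a := by
    rintro p q rfl; rw [add_smul, one_smul, add_assoc]
  apply le_antisymm
  -- The structure maps carry the stable stage onto itself, so preimages can be chosen successively
  -- to the left.
  · intro t ht
    exact (A.line x).exists_limProj_eq (fun q => A.imgSub A.stabOrd (x + q • a))
      (fun q r h => (A.imgSub_stabOrd_map _ _ (hstep q r h)).ge) p t ht
  · rintro _ ⟨s, rfl⟩
    -- All coordinates are treated at once, because membership at a successor stage uses the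
    -- preceding coordinate at the earlier stage.
    have key : ∀ (τ : Ordinal.{v}) (q : ℤ),
        (show A.obj (x + q • a) from s.1 q) ∈ A.imgSub τ (x + q • a) := by
      intro τ
      induction τ using Ordinal.limitRecOn with
      | zero =>
        intro q
        rw [imgSub, OrdinalApprox.gfpApprox_zero]
        exact Submodule.mem_top
      | add_one τ ih =>
        intro q
        rw [imgSub, OrdinalApprox.gfpApprox_add_one _ le_top]
        have key' : ∀ (z : ι) (hz : z = x + (q - 1) • a) (h : z + a = x + q • a),
            (show A.obj (x + q • a) from s.1 q) ∈ (A.imgSub τ z).map (A.map z _ h) := by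
          rintro z rfl h
          exact ⟨_, ih (q - 1), (A.line x).map_limProj s (q - 1) q (by omega)⟩
        exact key' _ (by rw [sub_smul, one_smul, add_sub_assoc]) _
      | limit τ hτ ih =>
        intro q
        rw [imgSub, OrdinalApprox.gfpApprox_of_isSuccLimit _ hτ, iInf_apply, Submodule.mem_iInf]
        exact fun b => ih b.1 b.2 q
    exact key _ p

/-- The kernels of the projections to the stable image quotient diagram are the kernels of the maps
of the colimit cocone. -/
theorem quoKer_stabOrd_eq_ker (A : ShiftDiagram.{u, v} R ι a) (x : ι) (p : ℤ) :
    A.quoKer A.stabOrd (x + p • a) = LinearMap.ker ((A.line x).colimIncl p) := by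
  ext t
  rw [mem_quoKer_stabOrd]
  refine Iff.trans ?_ ((A.line x).colimIncl_eq_zero_iff p t).symm
  constructor
  · rintro ⟨n, hn⟩
    refine ⟨p + n, by omega, ?_⟩
    have h' : x + p • a + (p + n - p).toNat • a = x + (p + n) • a := by
      rw [add_sub_cancel_left, Int.toNat_natCast, add_smul, natCast_zsmul, add_assoc]
    exact (A.line_iter x _ p (p + n) _ h' t).trans
      (A.iter_eq_zero_of_eq rfl h' (by omega) hn)
  · rintro ⟨q, h, ht⟩
    have h' : x + p • a + (q - p).toNat • a = x + q • a := by
      rw [← natCast_zsmul, Int.toNat_of_nonneg (by omega), sub_smul]; abel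
    exact ⟨_, A.iter_eq_zero_of_eq h' rfl rfl ((A.line_iter x _ p q _ h' t).symm.trans ht)⟩

end Line

end ShiftDiagram

end ExactCouples

/-! ### From graded isomorphisms to isomorphisms of abutments. -/

namespace ExactCouples

namespace ShiftDiagram

namespace Hom

variable {R : Type u} [Ring R] {A B : ZDiagram.{u, v} R} (f : Hom A B)

theorem imGrMap_injective_iff (p : ℤ) : Function.Injective (f.imGrMap p) ↔
    ∀ x ∈ A.imFil p, f.colimMap x ∈ B.imFil (p - 1) → x ∈ A.imFil (p - 1) :=
  Subquot.map_injective_iff _ _ _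

theorem imGrMap_surjective_iff (p : ℤ) : Function.Surjective (f.imGrMap p) ↔
    ∀ y ∈ B.imFil p, ∃ x ∈ A.imFil p, f.colimMap x - y ∈ B.imFil (p - 1) :=
  Subquot.map_surjective_iff _ _ _

theorem kerGrMap_injective_iff (p : ℤ) : Function.Injective (f.kerGrMap p) ↔
    ∀ s ∈ A.kerFil (p + 1), f.limMap s ∈ B.kerFil p → s ∈ A.kerFil p :=
  Subquot.map_injective_iff _ _ _

theorem kerGrMap_surjective_iff (p : ℤ) : Function.Surjective (f.kerGrMap p) ↔
    ∀ s ∈ B.kerFil (p + 1), ∃ t ∈ A.kerFil (p + 1), f.limMap t - s ∈ B.kerFil p :=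
  Subquot.map_surjective_iff _ _ _

/-- Graded injectivity pushes an element of the kernel down through every filtration stage. It then
defines a constant family in the limit of the filtration, where injectivity kills it. -/
theorem colimMap_injective (hgr : ∀ p, Function.Injective (f.imGrMap p))
    (hlim : Function.Injective f.imFilMap.limMap) : Function.Injective f.colimMap := by
  rw [injective_iff_map_eq_zero]
  intro x hx
  obtain ⟨p, hp⟩ := A.exists_mem_imFil x
  have hk : ∀ k : ℕ, x ∈ A.imFil (p - k) := by
    intro k
    induction k with
    | zero => simpa using hp
    | succ k ih =>
      have := (f.imGrMap_injective_iff _).1 (hgr _) x ih (by rw [hx]; exact zero_mem _)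
      rwa [sub_sub, ← Nat.cast_succ] at this
  have hq : ∀ q, x ∈ A.imFil q := fun q =>
    A.monotone_imFil (show p - ((p - q).toNat : ℕ) ≤ q by omega) (hk _)
  let s : A.imFilDiagram.lim := ⟨fun q => ⟨x, hq q⟩, (mem_lim _ _).2 fun _ _ _ => rfl⟩
  have hs : f.imFilMap.limMap s = 0 := Subtype.ext (funext fun q => Subtype.ext hx)
  have hs0 : s = 0 := hlim (hs.trans (map_zero _).symm)
  have := congrFun (congrArg Subtype.val hs0) p
  exact congrArg Subtype.val this

/-- Graded surjectivity approximates `y` ever more deeply, but the corrections cannot simply be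
summed. Injectivity on `lim¹` makes the family of corrections a `diff`, and surjectivity on `lim`
removes the remaining error. -/
theorem colimMap_surjective (hgr : ∀ p, Function.Surjective (f.imGrMap p))
    (hlim : Function.Surjective f.imFilMap.limMap)
    (hlim1 : Function.Injective f.imFilMap.lim1Map) : Function.Surjective f.colimMap := by
  intro y
  obtain ⟨p, hp⟩ := B.exists_mem_imFil y
  have step : ∀ (q : ℤ) (u : B.imFil q), ∃ t : A.imFil q, u.1 - f.colimMap t.1 ∈ B.imFil (q - 1) := by
    intro q u
    obtain ⟨t, ht, h⟩ := (f.imGrMap_surjective_iff q).1 (hgr q) u.1 u.2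
    refine ⟨⟨t, ht⟩, ?_⟩
    rw [← neg_mem_iff, neg_sub]
    exact h
  choose next hnext using step
  -- the remainders of the successive approximations of `y`
  let rem : ℕ → B.colim := fun k => Nat.rec (motive := fun _ => B.colim) y (fun k u =>
    -- The value `0` only makes the recursion total; `hrem_mem` shows that this branch never occurs.
    open Classical in if h : u ∈ B.imFil (p - k) then u - f.colimMap (next _ ⟨u, h⟩).1 else 0) k
  have hrem_mem : ∀ k : ℕ, rem k ∈ B.imFil (p - k) := by
    intro k
    induction k with
    | zero =>
      change y ∈ _
      simpa using hp
    | succ k ih =>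
      have h : rem (k + 1) = rem k - f.colimMap (next _ ⟨rem k, ih⟩).1 := dif_pos ih
      rw [h, Nat.cast_succ, ← sub_sub]
      exact hnext _ ⟨rem k, ih⟩
  have hrem : ∀ k : ℕ, ∃ t ∈ A.imFil (p - k), f.colimMap t = rem k - rem (k + 1) := by
    intro k
    have h : rem (k + 1) = rem k - f.colimMap (next _ ⟨rem k, hrem_mem k⟩).1 :=
      dif_pos (hrem_mem k)
    exact ⟨_, (next _ ⟨rem k, hrem_mem k⟩).2, by rw [h, sub_sub_cancel]⟩
  -- For `q ≥ p` truncation makes this family constantly `y`, so no correction is needed above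
  -- position `p`.
  let u : ∀ q, B.imFilDiagram.obj q := fun q =>
    ⟨rem (p - q).toNat, B.monotone_imFil (by omega) (hrem_mem _)⟩
  have hex : ∀ q, ∃ t : A.imFil q, f.colimMap t.1 = (u q).1 - (u (q - 1)).1 := by
    intro q
    change ∃ t : A.imFil q, f.colimMap t.1 = rem (p - q).toNat - rem (p - (q - 1)).toNat
    rcases le_or_gt q p with h | h
    · obtain ⟨t, ht, h'⟩ := hrem (p - q).toNat
      refine ⟨⟨t, A.monotone_imFil (by omega) ht⟩, ?_⟩
      rw [h', show (p - (q - 1)).toNat = (p - q).toNat + 1 by omega]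
    · refine ⟨0, ?_⟩
      rw [show (p - (q - 1)).toNat = (p - q).toNat by omega, sub_self]
      exact map_zero _
  choose t ht using hex
  have hdiff : B.imFilDiagram.diff u = f.imFilMap.piMap t :=
    funext fun q => Subtype.ext (ht q).symm
  -- The image of the class of `t` in `lim¹` is trivial, being represented by `diff u`.
  obtain ⟨v, hv⟩ : ∃ v, A.imFilDiagram.diff v = t := by
    have h0 : f.imFilMap.lim1Map (Submodule.Quotient.mk t) = 0 :=
      (Submodule.Quotient.mk_eq_zero _).2 ⟨u, hdiff⟩
    exact (Submodule.Quotient.mk_eq_zero _).1 (hlim1 (h0.trans (map_zero _).symm))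
  have hw : f.imFilMap.piMap v - u ∈ B.imFilDiagram.lim := by
    change B.imFilDiagram.diff _ = 0
    rw [map_sub, diff_piMap, hv, hdiff, sub_self]
  obtain ⟨w, hw'⟩ := hlim ⟨_, hw⟩
  have h1 : f.colimMap (w.1 p).1 = f.colimMap (v p).1 - (u p).1 :=
    congrArg Subtype.val (congrFun (congrArg Subtype.val hw') p)
  have h2 : (u p).1 = y := by
    change rem (p - p).toNat = y
    rw [sub_self]
    rfl
  refine ⟨(v p).1 - (w.1 p).1, ?_⟩
  rw [map_sub, h1, sub_sub_cancel, h2]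

/-- Injectivity on the images in the colimits places an element of the kernel in some filtration
stage. Graded injectivity then moves it into all stages, so every coordinate vanishes. -/
theorem limMap_injective (hgr : ∀ p, Function.Injective (f.kerGrMap p))
    (him : Function.Injective f.imLimMap) : Function.Injective f.limMap := by
  rw [injective_iff_map_eq_zero]
  intro s hs
  obtain ⟨p, hp⟩ : ∃ p, s ∈ A.kerFil p := by
    rw [← limToColim_eq_zero_iff]
    have h : f.imLimMap ⟨A.limToColim s, s, rfl⟩ = 0 := by
      refine Subtype.ext ?_
      change f.colimMap (A.colimIncl 0 (A.limProj 0 s)) = 0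
      rw [colimMap_colimIncl, ← limProj_limMap, hs, map_zero, map_zero]
    exact congrArg Subtype.val (him (h.trans (map_zero _).symm))
  have hk : ∀ k : ℕ, s ∈ A.kerFil (p - k) := by
    intro k
    induction k with
    | zero => simpa using hp
    | succ k ih =>
      refine (f.kerGrMap_injective_iff _).1 (hgr _) s ?_ (by rw [hs]; exact zero_mem _)
      rwa [Nat.cast_succ, ← sub_sub, sub_add_cancel]
  exact Subtype.ext (funext fun q =>
    A.monotone_kerFil (show p - ((p - q).toNat : ℕ) ≤ q by omega) (hk _))

/-- The limit is complete for its kernel filtration: the correction at step `k` vanishes in all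
coordinates from `p - k` on, so successive approximations converge coordinatewise. -/
theorem exists_limMap_eq_of_mem_kerFil (hgr : ∀ p, Function.Surjective (f.kerGrMap p)) (p : ℤ)
    (y : B.lim) (hy : y ∈ B.kerFil p) : ∃ s, f.limMap s = y := by
  have step : ∀ (k : ℕ) (s : {s : A.lim // y - f.limMap s ∈ B.kerFil (p - k)}),
      ∃ s' : {s : A.lim // y - f.limMap s ∈ B.kerFil (p - (k + 1 : ℕ))},
        s'.1 - s.1 ∈ A.kerFil (p - k) := by
    rintro k ⟨s, hs⟩
    change ∃ s' : {s : A.lim // y - f.limMap s ∈ B.kerFil (p - (k + 1 : ℕ))},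
      s'.1 - s ∈ A.kerFil (p - k)
    -- The graded piece between the stages `p - k` and `p - (k + 1)` carries the lower index.
    rw [show p - (k : ℤ) = p - (k + 1 : ℕ) + 1 by push_cast; ring] at hs ⊢
    obtain ⟨t, ht, h⟩ := (f.kerGrMap_surjective_iff _).1 (hgr _) _ hs
    refine ⟨⟨s + t, ?_⟩, by simpa using ht⟩
    rw [map_add, ← neg_mem_iff]
    convert h using 1
    abel
  choose next hnext using step
  let g : ∀ k : ℕ, {s : A.lim // y - f.limMap s ∈ B.kerFil (p - k)} :=
    fun k => Nat.rec ⟨0, by simpa using hy⟩ next k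
  have hg : ∀ k : ℕ, (g (k + 1)).1 - (g k).1 ∈ A.kerFil (p - k) := fun k => hnext k (g k)
  have hcoord : ∀ (q : ℤ) (k l : ℕ), p - k ≤ q → k ≤ l →
      A.limProj q (g l).1 = A.limProj q (g k).1 := by
    intro q k l hq hkl
    induction l, hkl using Nat.le_induction with
    | base => rfl
    | succ l hkl ih =>
      have h : A.limProj q ((g (l + 1)).1 - (g l).1) = 0 :=
        A.monotone_kerFil (show p - (l : ℤ) ≤ q by omega) (hg l)
      rw [map_sub, sub_eq_zero] at h
      rw [h, ih]
  let s : A.lim := ⟨fun q => A.limProj q (g (p - q).toNat).1, by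
    rw [mem_lim]
    intro q r h
    rw [A.map_limProj _ q r h]
    exact hcoord r _ _ (by omega) (by omega)⟩
  refine ⟨s, Subtype.ext (funext fun q => ?_)⟩
  have h : B.limProj q (y - f.limMap (g (p - q).toNat).1) = 0 :=
    B.monotone_kerFil (by omega) (g (p - q).toNat).2
  rw [map_sub, sub_eq_zero] at h
  exact h.symm

/-- After subtracting a lift of its image in the colimit, `y` lies in some filtration stage, where
completeness applies. -/
theorem limMap_surjective (hgr : ∀ p, Function.Surjective (f.kerGrMap p))
    (him : Function.Surjective f.imLimMap) : Function.Surjective f.limMap := by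
  intro y
  obtain ⟨⟨_, s, rfl⟩, hs⟩ := him ⟨B.limToColim y, y, rfl⟩
  have hs' : B.limToColim (f.limMap s) = B.limToColim y :=
    (f.colimMap_colimIncl 0 (A.limProj 0 s)).symm.trans (congrArg Subtype.val hs)
  obtain ⟨p, hp⟩ := (B.limToColim_eq_zero_iff (y - f.limMap s)).1 (by rw [map_sub, hs', sub_self])
  obtain ⟨t, ht⟩ := f.exists_limMap_eq_of_mem_kerFil hgr p _ hp
  exact ⟨s + t, by rw [map_add, ht, add_sub_cancel]⟩

end Hom

/-! ### The extension of the graded quotients of limit and colimit -/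

section GrSequence

variable {R : Type u} [Ring R]

/-- An exact sequence `A (p - 1) → A p → E → D p → D (p + 1)` that connects two diagrams. -/
structure GrSequence (A D : ZDiagram.{u, v} R) (p : ℤ) where
  E : ModuleCat.{v} R
  j : A.obj p →ₗ[R] E
  k : E →ₗ[R] D.obj p
  exact_i_j : Function.Exact (A.map (p - 1) p (sub_add_cancel p 1)) j
  exact_j_k : Function.Exact j k
  exact_k_i : Function.Exact k (D.map p (p + 1) rfl)

namespace GrSequence

variable {A D : ZDiagram.{u, v} R} {p : ℤ}

/-- The elements of the middle term whose image under `k` extends to a compatible family. -/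
def stableCycles (S : GrSequence A D p) : Submodule R S.E :=
  (LinearMap.range (D.limProj p)).comap S.k

/-- The images under `j` of the elements that vanish in the colimit. -/
noncomputable def stableBoundaries (S : GrSequence A D p) : Submodule R S.E :=
  (LinearMap.ker (A.colimIncl p)).map S.j

/-- Since `i k = 0`, any compatible family through `k e` vanishes one position later. With
`exists_k_eq`, `k` therefore maps the stable subquotient onto the kernel-filtration quotient. -/
theorem mem_stableCycles_iff (S : GrSequence A D p) (e : S.E) :
    e ∈ S.stableCycles ↔ ∃ s ∈ D.kerFil (p + 1), D.limProj p s = S.k e := by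
  constructor
  · rintro ⟨s, hs⟩
    refine ⟨s, ?_, hs⟩
    change D.limProj (p + 1) s = 0
    rw [← D.map_limProj s p (p + 1) rfl, hs, S.exact_k_i.apply_apply_eq_zero]
  · rintro ⟨s, -, hs⟩
    exact ⟨s, hs⟩

theorem exists_k_eq (S : GrSequence A D p) (s : D.lim) (hs : s ∈ D.kerFil (p + 1)) :
    ∃ e ∈ S.stableCycles, S.k e = D.limProj p s := by
  have hs' : D.limProj (p + 1) s = 0 := hs
  rw [← D.map_limProj s p (p + 1) rfl] at hs'
  obtain ⟨e, he⟩ := (S.exact_k_i _).1 hs'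
  exact ⟨e, ⟨s, he.symm⟩, he⟩

theorem j_mem_stableCycles (S : GrSequence A D p) (t : A.obj p) : S.j t ∈ S.stableCycles :=
  ⟨0, by rw [S.exact_j_k.apply_apply_eq_zero, map_zero]⟩

/-- This embeds the image-filtration quotient into the stable subquotient: by exactness, `t` can be
altered by an image from `A (p - 1)` without changing `j t`. -/
theorem j_mem_stableBoundaries_iff (S : GrSequence A D p) (t : A.obj p) :
    S.j t ∈ S.stableBoundaries ↔ A.colimIncl p t ∈ A.imFil (p - 1) := by
  constructor
  · rintro ⟨u, hu, htu⟩
    have hu' : A.colimIncl p u = 0 := hu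
    obtain ⟨w, hw⟩ := (S.exact_i_j (t - u)).1 (by rw [map_sub, htu, sub_self])
    refine ⟨w, ?_⟩
    rw [← A.colimIncl_map (p - 1) p (sub_add_cancel p 1), hw, map_sub, hu', sub_zero]
  · rintro ⟨w, hw⟩
    rw [← A.colimIncl_map (p - 1) p (sub_add_cancel p 1)] at hw
    refine ⟨t - A.map (p - 1) p (sub_add_cancel p 1) w, ?_, ?_⟩
    · change A.colimIncl p _ = 0
      rw [map_sub, hw, sub_self]
    · rw [map_sub, S.exact_i_j.apply_apply_eq_zero, sub_zero]

theorem k_eq_zero_of_mem_stableBoundaries (S : GrSequence A D p) {e : S.E}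
    (he : e ∈ S.stableBoundaries) : S.k e = 0 := by
  obtain ⟨t, -, rfl⟩ := he
  exact S.exact_j_k.apply_apply_eq_zero t

variable {A₁ A₂ D₁ D₂ : ZDiagram.{u, v} R}

/-- Morphisms of connecting exact sequences over given morphisms of diagrams. -/
structure Hom (f : ShiftDiagram.Hom A₁ A₂) (g : ShiftDiagram.Hom D₁ D₂) (S₁ : GrSequence A₁ D₁ p)
    (S₂ : GrSequence A₂ D₂ p) where
  onE : S₁.E →ₗ[R] S₂.E
  comm_j : ∀ t, onE (S₁.j t) = S₂.j (f.app p t)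
  comm_k : ∀ e, g.app p (S₁.k e) = S₂.k (onE e)

namespace Hom

variable {f : ShiftDiagram.Hom A₁ A₂} {g : ShiftDiagram.Hom D₁ D₂} {S₁ : GrSequence A₁ D₁ p}
  {S₂ : GrSequence A₂ D₂ p} (φ : Hom f g S₁ S₂)

theorem onE_mem_stableCycles : ∀ e ∈ S₁.stableCycles, φ.onE e ∈ S₂.stableCycles := by
  rintro e ⟨s, hs⟩
  exact ⟨g.limMap s, by rw [g.limProj_limMap, hs, φ.comm_k]⟩

theorem onE_mem_stableBoundaries : ∀ e ∈ S₁.stableBoundaries, φ.onE e ∈ S₂.stableBoundaries := by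
  rintro _ ⟨t, ht, rfl⟩
  have ht' : A₁.colimIncl p t = 0 := ht
  refine ⟨f.app p t, ?_, (φ.comm_j t).symm⟩
  change A₂.colimIncl p _ = 0
  rw [← f.colimMap_colimIncl, ht', map_zero]

/-- The induced map of the stable subquotients of the middle terms. -/
noncomputable def stableMap : Subquot S₁.stableCycles S₁.stableBoundaries →ₗ[R]
    Subquot S₂.stableCycles S₂.stableBoundaries :=
  Subquot.map φ.onE φ.onE_mem_stableCycles φ.onE_mem_stableBoundaries

theorem imGrMap_injective (h : Function.Injective φ.stableMap) :
    Function.Injective (f.imGrMap p) := by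
  rw [stableMap, Subquot.map_injective_iff] at h
  rw [ShiftDiagram.Hom.imGrMap_injective_iff]
  rintro _ ⟨t, rfl⟩ ht
  rw [f.colimMap_colimIncl, ← S₂.j_mem_stableBoundaries_iff, ← φ.comm_j] at ht
  exact (S₁.j_mem_stableBoundaries_iff t).1 (h _ (S₁.j_mem_stableCycles t) ht)

theorem kerGrMap_surjective (h : Function.Surjective φ.stableMap) :
    Function.Surjective (g.kerGrMap p) := by
  rw [stableMap, Subquot.map_surjective_iff] at h
  rw [ShiftDiagram.Hom.kerGrMap_surjective_iff]
  intro s hs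
  obtain ⟨e', he', hk⟩ := S₂.exists_k_eq s hs
  obtain ⟨e, he, hee⟩ := h e' he'
  obtain ⟨t, ht, hkt⟩ := (S₁.mem_stableCycles_iff e).1 he
  refine ⟨t, ht, ?_⟩
  change D₂.limProj p _ = 0
  rw [map_sub, g.limProj_limMap, hkt, φ.comm_k, ← hk, ← map_sub]
  exact S₂.k_eq_zero_of_mem_stableBoundaries hee

theorem kerGrMap_injective (h : Function.Injective φ.stableMap)
    (h' : Function.Surjective (f.imGrMap p)) : Function.Injective (g.kerGrMap p) := by
  rw [stableMap, Subquot.map_injective_iff] at h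
  rw [ShiftDiagram.Hom.imGrMap_surjective_iff] at h'
  rw [ShiftDiagram.Hom.kerGrMap_injective_iff]
  intro s hs hgs
  have hgs' : D₂.limProj p (g.limMap s) = 0 := hgs
  change D₁.limProj p s = 0
  obtain ⟨e, he, hk⟩ := S₁.exists_k_eq s hs
  rw [g.limProj_limMap, ← hk, φ.comm_k] at hgs'
  obtain ⟨t', ht'⟩ := (S₂.exact_j_k _).1 hgs'
  obtain ⟨_, ⟨t, rfl⟩, ht⟩ := h' _ ⟨t', rfl⟩
  -- The choice of `t` makes `φ.onE (S₁.j t - e)` a stable boundary, so injectivity applies to `S₁.j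
  -- t - e`; applying `k` then gives `k e = 0`.
  rw [f.colimMap_colimIncl, ← map_sub, ← S₂.j_mem_stableBoundaries_iff, map_sub, ← φ.comm_j, ht',
    ← map_sub] at ht
  have := S₁.k_eq_zero_of_mem_stableBoundaries (h _ (sub_mem (S₁.j_mem_stableCycles t) he) ht)
  rwa [map_sub, S₁.exact_j_k.apply_apply_eq_zero, zero_sub, neg_eq_zero, hk] at this

theorem imGrMap_surjective (h : Function.Surjective φ.stableMap)
    (h' : Function.Injective (g.kerGrMap p)) : Function.Surjective (f.imGrMap p) := by
  rw [stableMap, Subquot.map_surjective_iff] at h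
  rw [ShiftDiagram.Hom.kerGrMap_injective_iff] at h'
  rw [ShiftDiagram.Hom.imGrMap_surjective_iff]
  rintro _ ⟨t', rfl⟩
  obtain ⟨e, he, hee⟩ := h _ (S₂.j_mem_stableCycles t')
  obtain ⟨s, hs, hks⟩ := (S₁.mem_stableCycles_iff e).1 he
  have h0 := S₂.k_eq_zero_of_mem_stableBoundaries hee
  rw [map_sub, S₂.exact_j_k.apply_apply_eq_zero, sub_zero, ← φ.comm_k, ← hks,
    ← g.limProj_limMap] at h0
  -- Injectivity on the limit side gives `k e = 0`, so the preimage `e` of the class of `j t'`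
  -- itself comes from `A₁`.
  have hs0 : D₁.limProj p s = 0 := h' s hs h0
  obtain ⟨t, rfl⟩ := (S₁.exact_j_k e).1 (hks.symm.trans hs0)
  refine ⟨_, ⟨t, rfl⟩, ?_⟩
  rwa [φ.comm_j, ← map_sub, S₂.j_mem_stableBoundaries_iff, map_sub, ← f.colimMap_colimIncl] at hee

/-- If the stable subquotients are isomorphic, then the graded quotients of the colimits are
isomorphic if and only if those of the limits are. -/
theorem bijective_gr (h : Function.Bijective φ.stableMap)
    (h' : Function.Surjective (f.imGrMap p) ∨ Function.Injective (g.kerGrMap p)) :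
    Function.Bijective (f.imGrMap p) ∧ Function.Bijective (g.kerGrMap p) := by
  rcases h' with h' | h'
  · exact ⟨⟨φ.imGrMap_injective h.1, h'⟩, φ.kerGrMap_injective h.1 h', φ.kerGrMap_surjective h.2⟩
  · exact ⟨⟨φ.imGrMap_injective h.1, φ.imGrMap_surjective h.2 h'⟩, h', φ.kerGrMap_surjective h.2⟩

end Hom

end GrSequence

end GrSequence

end ShiftDiagram

end ExactCouples

/-! ### The connecting sequences of a regular exact couple. -/

namespace ExactCouples

namespace ExactCouple

variable {R : Type u} [Ring R] {a b c : ℤ × ℤ}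

/-- Regularity enters through `σ² = 1`: a shift by `b + c` leads exactly to the base point for `n +
σ`, with no offset along `a`. -/
theorem base_add_sigma {C : ExactCouple.{u, v} R a b c} (hC : C.IsRegular) (n : ℤ) :
    C.base (n + C.sigma) = C.base n + (b + c) := by
  have h : C.sigma * C.sigma = 1 := by rcases hC with h | h <;> rw [h] <;> rfl
  rw [base, base, mul_add, h, add_smul, one_smul]

theorem base_add_b_add_c {C : ExactCouple.{u, v} R a b c} (hC : C.IsRegular) (n p : ℤ) :
    C.base n + p • a + b + c = C.base (n + C.sigma) + p • a := by
  rw [base_add_sigma hC]; abel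

theorem det2_base {C : ExactCouple.{u, v} R a b c} (hC : C.IsRegular) (n p : ℤ) :
    det2 a (C.base n + p • a) = n := by
  have h : C.sigma * C.sigma = 1 := by rcases hC with h | h <;> rw [h] <;> rfl
  have h' : det2 a (C.base n + p • a) = C.sigma * n * C.sigma := by
    change _ = C.sigma * n * det2 a (b + c)
    simp only [det2, base, Matrix.det_fin_two_of, Prod.fst_add, Prod.snd_add, Prod.smul_fst,
      Prod.smul_snd, smul_eq_mul]
    ring
  rw [h', mul_right_comm, h, one_mul]

/-- The part of an exact couple that connects the diagrams in positions `n` and `n + σ`. -/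
def grSequence (C : ExactCouple.{u, v} R a b c) (hC : C.IsRegular) (n p : ℤ) :
    ShiftDiagram.GrSequence (C.diagram n) (C.diagram (n + C.sigma)) p where
  E := C.E (C.base n + p • a + b)
  j := C.j (C.base n + p • a) _ rfl
  k := C.k _ (C.base (n + C.sigma) + p • a) (base_add_b_add_c hC n p)
  exact_i_j := C.exact_i_j _ _ _ _ _
  exact_j_k := C.exact_j_k _ _ _ _ _
  exact_k_i := C.exact_k_i _ _ _ _ _

theorem stableCycles_grSequence (C : ExactCouple.{u, v} R a b c) (hC : C.IsRegular) (n p : ℤ) :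
    (C.grSequence hC n p).stableCycles = C.cyclesOrd C.D.stabOrd (C.base n + p • a + b) := by
  have key : ∀ (y z : ℤ × ℤ) (h : y + c = z), C.cyclesOrd C.D.stabOrd y =
      (C.D.imgSub C.D.stabOrd z).comap (C.k y z h) := by rintro y _ rfl; rfl
  rw [key _ _ (base_add_b_add_c hC n p), ShiftDiagram.imgSub_stabOrd_eq_range]
  rfl

theorem stableBoundaries_grSequence (C : ExactCouple.{u, v} R a b c) (hC : C.IsRegular)
    (n p : ℤ) : (C.grSequence hC n p).stableBoundaries =
      C.boundariesOrd C.D.stabOrd (C.base n + p • a + b) := by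
  have key : ∀ (x y : ℤ × ℤ) (h : x + b = y), C.boundariesOrd C.D.stabOrd y =
      (C.D.quoKer C.D.stabOrd x).map (C.j x y h) := by
    intro x y h
    obtain rfl : x = y - b := by rw [← h, add_sub_cancel_right]
    rfl
  rw [key _ _ rfl, ShiftDiagram.quoKer_stabOrd_eq_ker]
  rfl

namespace Hom

variable {C₁ C₂ : ExactCouple.{u, v} R a b c} (f : Hom C₁ C₂)

/-- The part of a morphism of exact couples that connects the diagrams in positions `n` and
`n + σ`. -/
def grSequenceMap (hC₁ : C₁.IsRegular) (hC₂ : C₂.IsRegular) (n p : ℤ) :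
    ShiftDiagram.GrSequence.Hom (f.diagramMap n) (f.diagramMap (n + C₁.sigma))
      (C₁.grSequence hC₁ n p) (C₂.grSequence hC₂ n p) where
  -- Both couples have the same `sigma` and `base` by definition, as these depend only on the
  -- bidegrees.
  onE := f.onE _
  comm_j := f.comm_j _ _ _
  comm_k := f.comm_k _ _ _

/-- If the limit pages are stable and isomorphic, then so are the stable objects. -/
theorem stableMap_bijective (hC₁ : C₁.IsRegular) (hC₂ : C₂.IsRegular) (n p : ℤ)
    (h₁ : C₁.IsStableAt (C₁.base n + p • a + b)) (h₂ : C₂.IsStableAt (C₁.base n + p • a + b))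
    (h : Function.Bijective (f.inftyMap (C₁.base n + p • a + b))) :
    Function.Bijective (f.grSequenceMap hC₁ hC₂ n p).stableMap := by
  have hZ₁ := SetLike.ext_iff.1 (C₁.stableCycles_grSequence hC₁ n p)
  have hB₁ := SetLike.ext_iff.1 (C₁.stableBoundaries_grSequence hC₁ n p)
  have hZ₂ := SetLike.ext_iff.1 (C₂.stableCycles_grSequence hC₂ n p)
  have hB₂ := SetLike.ext_iff.1 (C₂.stableBoundaries_grSequence hC₂ n p)
  have hmem : ∀ e ∈ C₁.cyclesOrd C₁.D.stabOrd (C₁.base n + p • a + b),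
      f.onE _ e ∈ C₂.cyclesOrd C₂.D.stabOrd (C₁.base n + p • a + b) := fun e he =>
    (hZ₂ _).1 ((f.grSequenceMap hC₁ hC₂ n p).onE_mem_stableCycles e ((hZ₁ e).2 he))
  obtain ⟨i₁, s₁⟩ := h₁
  obtain ⟨i₂, -⟩ := h₂
  obtain ⟨i, s⟩ := h
  rw [stableToInfty, Subquot.map_injective_iff] at i₁ i₂
  rw [stableToInfty, Subquot.map_surjective_iff] at s₁
  rw [inftyMap, Subquot.map_injective_iff] at i
  rw [inftyMap, Subquot.map_surjective_iff] at s
  have hle : ∀ e ∈ C₁.boundariesInfty (C₁.base n + p • a + b),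
      f.onE _ e ∈ C₂.boundariesInfty (C₁.base n + p • a + b) := fun e he =>
    (iSup_le fun r e he => Submodule.mem_iSup_of_mem r (f.onE_mem_boundaries r _ e he) :
      C₁.boundariesInfty _ ≤ (C₂.boundariesInfty _).comap (f.onE _)) he
  constructor
  · refine (Subquot.map_injective_iff _ _ _).2 ?_
    intro e he hfe
    have he' := (hZ₁ e).1 he
    exact (hB₁ e).2 (i₁ e he' (i e (C₁.cyclesOrd_stabOrd_le _ he')
      (C₂.boundariesOrd_stabOrd_le _ ((hB₂ _).1 hfe))))
  · refine (Subquot.map_surjective_iff _ _ _).2 ?_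
    intro (e' : C₂.E (C₁.base n + p • a + b)) h'
    have he' := (hZ₂ e').1 h'
    obtain ⟨e, he, hee'⟩ := s e' (C₂.cyclesOrd_stabOrd_le _ he')
    -- The preimage found on the limit page need not be a stable cycle; stability of the source
    -- replaces it by one modulo boundaries. Injectivity for the target then turns the error into a
    -- stable boundary.
    obtain ⟨d, hd, hde⟩ := s₁ e he
    refine ⟨d, (hZ₁ d).2 hd, (hB₂ _).2 (i₂ _ (sub_mem (hmem d hd) he') ?_)⟩
    have := add_mem (hle _ hde) hee'
    rw [map_sub, LinearMap.id_apply, sub_add_sub_cancel] at this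
    exact this

end Hom

end ExactCouple

end ExactCouples

theorem mainTheorem6 {R : Type*} [Ring R] {a b c : ℤ × ℤ}
    (C₁ C₂ : ExactCouples.ExactCouple R a b c) (hC₁ : C₁.IsRegular) (hC₂ : C₂.IsRegular)
    (f : ExactCouples.ExactCouple.Hom C₁ C₂) (n : ℤ)
    (h_stable : ∀ x : ℤ × ℤ, ExactCouples.det2 a x = n →
      C₁.IsStableAt (x + b) ∧ C₂.IsStableAt (x + b))
    (h_infty : ∀ x : ℤ × ℤ, ExactCouples.det2 a x = n → Function.Bijective (f.inftyMap (x + b)))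
    (h_gr : ∀ r : ℤ, Function.Surjective ((f.diagramMap n).imGrMap r) ∨
      Function.Injective ((f.diagramMap (n + C₁.sigma)).kerGrMap r))
    (h_lim : Function.Bijective (f.diagramMap n).imFilMap.limMap)
    (h_lim1 : Function.Injective (f.diagramMap n).imFilMap.lim1Map)
    (h_im : Function.Bijective (f.diagramMap (n + C₁.sigma)).imLimMap) :
    Function.Bijective (f.diagramMap n).colimMap ∧
      Function.Bijective (f.diagramMap (n + C₁.sigma)).limMap := by
  have hgr : ∀ p, Function.Bijective ((f.diagramMap n).imGrMap p) ∧
      Function.Bijective ((f.diagramMap (n + C₁.sigma)).kerGrMap p) := fun p => by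
    have hp := ExactCouples.ExactCouple.det2_base hC₁ n p
    exact (f.grSequenceMap hC₁ hC₂ n p).bijective_gr
      (f.stableMap_bijective hC₁ hC₂ n p (h_stable _ hp).1 (h_stable _ hp).2 (h_infty _ hp))
      (h_gr p)
  exact ⟨⟨(f.diagramMap n).colimMap_injective (fun p => (hgr p).1.1) h_lim.1,
      (f.diagramMap n).colimMap_surjective (fun p => (hgr p).1.2) h_lim.2 h_lim1⟩,
    (f.diagramMap (n + C₁.sigma)).limMap_injective (fun p => (hgr p).2.1) h_im.1,
    (f.diagramMap (n + C₁.sigma)).limMap_surjective (fun p => (hgr p).2.2) h_im.2⟩
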